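/- A tower of topological groups is a sequence $(G_n)_{n\ge 0}$ of topological groups such that each $G_n$ is a subgroup of $G_{n+1}$ and carries the subspace topology; it is closed if each $G_n$ is closed in $G_{n+1}$. On the group $G=\bigcup_n G_n$, let $\tau_{ind}$ be the finest topology, and $\tau_{gr}$ the finest group topology, for which all inclusions $G_n\to G$ are continuous; the inductive limit of the tower is the topological group $(G,\tau_{gr})$. For a sequence $U=(U_n)_{n\ge 0}$ of open symmetric neighbourhoods $U_n$ of the identity in $G_n$, put $$U^+[k]=\bigcup_{n\ge k}U_kU_{k+1}\cdots U_n,\qquad U[k]=(U^+[k])^{-1}\,U^+[k].$$ The tower satisfies (GC) if for every such sequence $U$ and every $k\ge 0$ there is such a sequence $V$ with $V[k]\subseteq U^+[k]$. A Tychonoff space $X$ is an Ascoli space if every compact subset of $C(X,\mathbb R)$ with the compact-open topology is equicontinuous. An $\mathcal{MK}_\omega$-space is a topological space that is the inductive limit (as a topological space) of an increasing sequence of its compact metrizable subspaces. Theorem. Let $(G_n)_{n\ge 0}$ be a closed tower of metrizable groups that satisfies (GC), and let $G=(G,\tau_{gr})$ be its inductive limit. Then the following are equivalent: (i) $G$ is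 an Ascoli space; (ii) $\tau_{ind}$ is a group topology on $\bigcup_n G_n$; (iii) at least one of the following holds: $(iii)_1$ there is $m$ such that $G_n$ is open in $G_{n+1}$ for every $n\ge m$; $(iii)_2$ all the groups $G_n$ are locally compact. Moreover, if $(iii)_1$ holds, then $G$ is metrizable. If $(iii)_2$ holds, then $G$ contains an open subgroup that is an $\mathcal{MK}_\omega$-space and $G$ is sequential; if $(iii)_2$ holds and $(iii)_1$ does not, then in addition $G$ is not Fréchet–Urysohn. -/

import Mathlib

open scoped Pointwise

universe u

/-- A tower of topological groups with union `G`: subgroups `H 0 ≤ H 1 ≤ ⋯` of the abstract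
group `G` whose union is `G`, each with a group topology, such that the topology of `H n` is the
subspace topology inherited from `H (n + 1)`. The group `G` itself carries no topology here. -/
structure GroupTower (G : Type u) [Group G] where
  /-- the groups of the tower -/
  H : ℕ → Subgroup G
  /-- their topologies -/
  [top : ∀ n, TopologicalSpace (H n)]
  [isTopologicalGroup : ∀ n, IsTopologicalGroup (H n)]
  le_succ : ∀ n, H n ≤ H (n + 1)
  isEmbedding_inclusion : ∀ n, Topology.IsEmbedding (Subgroup.inclusion (le_succ n))
  exhaust : ∀ g : G, ∃ n, g ∈ H n

namespace GroupTower

attribute [instance] GroupTower.top GroupTower.isTopologicalGroup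

variable {G : Type u} [Group G] (T : GroupTower G)

/-- The tower is closed: each group is a closed subgroup of the next one. -/
def IsClosedTower : Prop :=
  ∀ n, IsClosed (Set.range (Subgroup.inclusion (T.le_succ n)))

/-- The `n`-th group is open in the next one. -/
def IsOpenStep (n : ℕ) : Prop :=
  IsOpen (Set.range (Subgroup.inclusion (T.le_succ n)))

/-- The topology of the inductive limit in the category of topological spaces: the finest
topology on the union for which all the inclusions are continuous. -/
abbrev indTopology : TopologicalSpace G :=
  ⨆ n, (T.top n).coinduced (Subtype.val : T.H n → G)

/-- The topology of the inductive limit in the category of topological groups: the finest group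
topology on the union for which all the inclusions are continuous (in the order on topologies,
`t ≤ s` means that `t` is finer than `s`). -/
abbrev grTopology : TopologicalSpace G :=
  sInf {t | @IsTopologicalGroup G t _ ∧
    ∀ n, @Continuous (T.H n) G (T.top n) t (Subtype.val : T.H n → G)}

/-- `grTopology` is the least element, i.e. the finest one, of the family of all group topologies
for which the inclusions are continuous. -/
theorem isLeast_grTopology :
    IsLeast {t | @IsTopologicalGroup G t _ ∧
      ∀ n, @Continuous (T.H n) G (T.top n) t (Subtype.val : T.H n → G)} T.grTopology :=
  ⟨⟨topologicalGroup_sInf fun _ ht => ht.1,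
    fun n => continuous_sInf_rng.2 fun _ ht => ht.2 n⟩, fun _ ht => sInf_le ht⟩

/-- Sequences `(U n)` where `U n` is an open symmetric neighbourhood of the identity in the
`n`-th group. -/
def IsSymmNhdSeq (U : ∀ n, Set (T.H n)) : Prop :=
  ∀ n, IsOpen (U n) ∧ 1 ∈ U n ∧ (U n)⁻¹ = U n

variable {T}

/-- The product `U k * U (k + 1) * ⋯ * U (k + j)` in `G`. -/
def partialProd (U : ∀ n, Set (T.H n)) (k : ℕ) : ℕ → Set G
  | 0 => Subtype.val '' U k
  | j + 1 => partialProd U k j * (Subtype.val '' U (k + j + 1))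

/-- The union over `n ≥ k` of the products `U k * U (k + 1) * ⋯ * U n`. -/
def plusSet (U : ∀ n, Set (T.H n)) (k : ℕ) : Set G :=
  ⋃ j, partialProd U k j

/-- The Bamboo-Shoot set of the sequence `U` that starts at `k`. -/
def bambooShoot (U : ∀ n, Set (T.H n)) (k : ℕ) : Set G :=
  (plusSet U k)⁻¹ * plusSet U k

variable (T)

/-- The Group Condition. -/
def GC : Prop :=
  ∀ U : ∀ n, Set (T.H n), T.IsSymmNhdSeq U → ∀ k : ℕ,
    ∃ V : ∀ n, Set (T.H n), T.IsSymmNhdSeq V ∧ bambooShoot V k ⊆ plusSet U k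

end GroupTower

/-- An Ascoli space: a Tychonoff space `X` such that every compact subset of `C(X, ℝ)`, with the
compact-open topology, is equicontinuous. -/
def IsAscoliSpace (X : Type u) [TopologicalSpace X] : Prop :=
  T35Space X ∧ ∀ K : Set C(X, ℝ), IsCompact K → Equicontinuous fun f : K => (f.1 : X → ℝ)

/-- An `MK_ω`-space: the topological inductive limit of an increasing sequence of compact
metrizable subspaces. -/
def IsMKOmegaSpace (X : Type u) [TopologicalSpace X] : Prop :=
  ∃ K : ℕ → Set X, Monotone K ∧ (∀ n, IsCompact (K n)) ∧
    (∀ n, TopologicalSpace.MetrizableSpace (K n)) ∧ (⋃ n, K n) = Set.univ ∧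
    ∀ s : Set X, IsOpen s ↔ ∀ n, IsOpen (Subtype.val ⁻¹' s : Set (K n))

/-- The topological group `X` contains an open subgroup that is an `MK_ω`-space. -/
def HasOpenMKOmegaSubgroup (X : Type u) [Group X] [TopologicalSpace X] : Prop :=
  ∃ S : Subgroup X, IsOpen (S : Set X) ∧ IsMKOmegaSpace S

open Filter Topology Set

/-! ### Products of neighbourhoods along the tower. -/

namespace GroupTower

variable {G : Type u} [Group G] {T : GroupTower G}

/-! (GC) makes the sets `plusSet U 0` a group filter basis, so they are neighbourhoods of the
identity for `grTopology` (`GC.plusSet_mem_nhds`). Conversely, if `U` shrinks fast, `plusSet U n`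
has a small trace on `H n` (`exists_plusSet_trace_subset`). Hence every `H n` is a closed
topological subgroup of the limit, and every compact set lies in some `H n`.

(iii) ⇒ (ii): if the steps are eventually open, some `H m` is open in `G`. If all groups are locally
compact and `O` contains 1 and has open traces, compact neighbourhoods `K n` are chosen recursively
with `K 0 * ⋯ * K n ⊆ O`; compactness of the product leaves room for the next factor.

(ii) ⇒ (i): the two topologies coincide, so `G` is a colimit of metrizable spaces, hence sequential,
and sequential Tychonoff spaces are Ascoli.

(i) ⇒ (iii): suppose `H m` is not locally compact and infinitely many steps are not open. Rows `x k`
in `H m`, ever closer to 1 and without convergent subsequences, are multiplied by sequences `y k`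
that tend to 1 outside ever larger groups. The products accumulate at 1, yet have open
neighbourhoods of which each compact set meets only finitely many; bump functions then contradict
the Ascoli property. A similar double sequence, with `x i` tending to 1, shows that `G` is not
Fréchet–Urysohn. -/

theorem monotone_H (T : GroupTower G) : Monotone T.H := monotone_nat_of_le_succ T.le_succ

theorem partialProd_succ' (U : ∀ n, Set (T.H n)) (k j : ℕ) :
    partialProd U k (j + 1) = Subtype.val '' U k * partialProd U (k + 1) j := by
  induction j with
  | zero => rfl
  | succ j ih =>
    rw [partialProd, ih, mul_assoc, partialProd, show k + 1 + j + 1 = k + (j + 1) + 1 by omega]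

theorem partialProd_mono {U V : ∀ n, Set (T.H n)} {k : ℕ} (h : ∀ n ≥ k, U n ⊆ V n) (j : ℕ) :
    partialProd U k j ⊆ partialProd V k j := by
  induction j with
  | zero => exact image_mono (h k le_rfl)
  | succ j ih => exact mul_subset_mul ih (image_mono (h _ (by omega)))

theorem plusSet_mono {U V : ∀ n, Set (T.H n)} {k : ℕ} (h : ∀ n ≥ k, U n ⊆ V n) :
    plusSet U k ⊆ plusSet V k :=
  iUnion_mono fun j => partialProd_mono h j

theorem image_subset_plusSet (U : ∀ n, Set (T.H n)) (k : ℕ) :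
    Subtype.val '' U k ⊆ plusSet U k :=
  subset_iUnion (partialProd U k) 0

theorem plusSet_eq {U : ∀ n, Set (T.H n)} (hU : ∀ n, 1 ∈ U n) (k : ℕ) :
    plusSet U k = Subtype.val '' U k * plusSet U (k + 1) := by
  apply Subset.antisymm
  · refine iUnion_subset fun j => ?_
    cases j with
    | zero =>
      intro x hx
      exact ⟨x, hx, 1, image_subset_plusSet U _ ⟨1, hU _, rfl⟩, mul_one x⟩
    | succ j =>
      rw [partialProd_succ']
      exact mul_subset_mul_left (subset_iUnion (partialProd U (k + 1)) j)
  · rintro _ ⟨x, hx, y, hy, rfl⟩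
    obtain ⟨j, hj⟩ := mem_iUnion.1 hy
    refine mem_iUnion.2 ⟨j + 1, ?_⟩
    rw [partialProd_succ']
    exact ⟨x, hx, y, hj, rfl⟩

theorem one_mem_plusSet {U : ∀ n, Set (T.H n)} (hU : ∀ n, 1 ∈ U n) (k : ℕ) :
    (1 : G) ∈ plusSet U k :=
  image_subset_plusSet U k ⟨1, hU k, rfl⟩

theorem IsSymmNhdSeq.one_mem {U : ∀ n, Set (T.H n)} (hU : T.IsSymmNhdSeq U) (n : ℕ) : 1 ∈ U n :=
  (hU n).2.1

theorem IsSymmNhdSeq.mem_nhds {U : ∀ n, Set (T.H n)} (hU : T.IsSymmNhdSeq U) (n : ℕ) :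
    U n ∈ 𝓝 (1 : T.H n) :=
  (hU n).1.mem_nhds (hU n).2.1

theorem isSymmNhdSeq_univ : T.IsSymmNhdSeq fun _ => univ :=
  fun _ => ⟨isOpen_univ, mem_univ _, inv_univ⟩

theorem IsSymmNhdSeq.inter {U V : ∀ n, Set (T.H n)} (hU : T.IsSymmNhdSeq U)
    (hV : T.IsSymmNhdSeq V) : T.IsSymmNhdSeq fun n => U n ∩ V n :=
  fun n => ⟨(hU n).1.inter (hV n).1, ⟨(hU n).2.1, (hV n).2.1⟩, by
    rw [inter_inv, (hU n).2.2, (hV n).2.2]⟩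

theorem IsSymmNhdSeq.update {U : ∀ n, Set (T.H n)} (hU : T.IsSymmNhdSeq U) {k : ℕ}
    {V : Set (T.H k)} (hV : IsOpen V ∧ 1 ∈ V ∧ V⁻¹ = V) :
    T.IsSymmNhdSeq (Function.update U k V) := by
  intro n
  rcases eq_or_ne n k with rfl | h
  · simpa using hV
  · simpa [h] using hU n

/-- In a topological group, every neighbourhood of the identity contains the square of an open
symmetric one. -/
theorem exists_symm_mul_subset {X : Type*} [Group X] [TopologicalSpace X] [IsTopologicalGroup X]
    {W : Set X} (hW : W ∈ 𝓝 1) :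
    ∃ V : Set X, (IsOpen V ∧ 1 ∈ V ∧ V⁻¹ = V) ∧ V * V ⊆ W := by
  obtain ⟨V, hVo, hV1, hV⟩ := exists_open_nhds_one_mul_subset hW
  refine ⟨V ∩ V⁻¹, ⟨hVo.inter hVo.inv, ⟨hV1, by simpa using hV1⟩, ?_⟩, ?_⟩
  · rw [inter_inv, inv_inv, inter_comm]
  · exact (mul_subset_mul inter_subset_left inter_subset_left).trans hV

/-- The factors with indices `k` and `k + 1` are both taken from a set `S` with `S * S ⊆ U (k + 1)`,
so together they fit into the single factor `U (k + 1)`. -/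
theorem exists_plusSet_subset_succ {U : ∀ n, Set (T.H n)} (hU : T.IsSymmNhdSeq U) (k : ℕ) :
    ∃ V, T.IsSymmNhdSeq V ∧ plusSet V k ⊆ plusSet U (k + 1) := by
  obtain ⟨S, hS, hSU⟩ := exists_symm_mul_subset (hU.mem_nhds (k + 1))
  let i := Subgroup.inclusion (T.le_succ k)
  have hi : Continuous i := (T.isEmbedding_inclusion k).continuous
  have hR : IsOpen (i ⁻¹' S) ∧ 1 ∈ i ⁻¹' S ∧ (i ⁻¹' S)⁻¹ = i ⁻¹' S := by
    refine ⟨hS.1.preimage hi, by simpa using hS.2.1, ?_⟩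
    conv_rhs => rw [← hS.2.2]
    ext x
    simp
  have hV := (hU.update hS).update hR
  refine ⟨_, hV, ?_⟩
  rw [plusSet_eq hV.one_mem, plusSet_eq hV.one_mem, plusSet_eq hU.one_mem (k + 1), ← mul_assoc]
  refine mul_subset_mul ?_ (plusSet_mono fun n hn => ?_)
  · rintro _ ⟨_, ⟨x, hx, rfl⟩, _, ⟨y, hy, rfl⟩, rfl⟩
    simp only [Function.update_self] at hx
    rw [Function.update_of_ne (by omega), Function.update_self] at hy
    exact ⟨i x * y, hSU (mul_mem_mul hx hy), rfl⟩
  · rw [Function.update_of_ne (by omega), Function.update_of_ne (by omega)]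

theorem exists_plusSet_zero_subset {U : ∀ n, Set (T.H n)} (hU : T.IsSymmNhdSeq U) (k : ℕ) :
    ∃ V, T.IsSymmNhdSeq V ∧ plusSet V 0 ⊆ plusSet U k := by
  induction k generalizing U with
  | zero => exact ⟨U, hU, Subset.rfl⟩
  | succ k ih =>
    obtain ⟨V, hV, hVU⟩ := exists_plusSet_subset_succ hU k
    obtain ⟨W, hW, hWV⟩ := ih hV
    exact ⟨W, hW, hWV.trans hVU⟩

theorem plusSet_subset_zero {U : ∀ n, Set (T.H n)} (hU : ∀ n, 1 ∈ U n) (k : ℕ) :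
    plusSet U k ⊆ plusSet U 0 := by
  induction k with
  | zero => exact Subset.rfl
  | succ k ih =>
    intro x hx
    apply ih
    rw [plusSet_eq hU]
    exact ⟨1, ⟨1, hU k, rfl⟩, x, hx, one_mul x⟩

theorem exists_conj_plusSet_subset {U : ∀ n, Set (T.H n)} (hU : T.IsSymmNhdSeq U) (g : G) :
    ∃ V, T.IsSymmNhdSeq V ∧ ∀ x ∈ plusSet V 0, g * x * g⁻¹ ∈ plusSet U 0 := by
  obtain ⟨m, hg⟩ := T.exhaust g
  -- For `n < m` the element `g` need not lie in `H n`. The condition is then vacuous, which is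
  -- harmless because only products starting at `m` are conjugated.
  let V : ∀ n, Set (T.H n) := fun n =>
    {x | ∀ h : m ≤ n, (⟨g, T.monotone_H h hg⟩ * x * ⟨g, T.monotone_H h hg⟩⁻¹ : T.H n) ∈ U n}
  have hV : T.IsSymmNhdSeq V := by
    intro n
    by_cases h : m ≤ n
    · let γ : T.H n := ⟨g, T.monotone_H h hg⟩
      have e : V n = (fun x => γ * x * γ⁻¹) ⁻¹' U n := by
        ext x; exact ⟨fun hx => hx h, fun hx _ => hx⟩
      rw [e]
      refine ⟨(hU n).1.preimage (by fun_prop), by simpa using hU.one_mem n, ?_⟩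
      conv_rhs => rw [← (hU n).2.2]
      ext x
      simp [mul_assoc]
    · have e : V n = univ := eq_univ_of_forall fun x h' => absurd h' h
      rw [e]
      exact isSymmNhdSeq_univ n
  obtain ⟨W, hW, hWV⟩ := exists_plusSet_zero_subset hV m
  refine ⟨W, hW, fun x hx => plusSet_subset_zero hU.one_mem m ?_⟩
  have key : ∀ j k, m ≤ k → ∀ x ∈ partialProd V k j, g * x * g⁻¹ ∈ partialProd U k j := by
    intro j
    induction j with
    | zero =>
      rintro k hk _ ⟨x, hx, rfl⟩
      exact ⟨_, hx hk, rfl⟩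
    | succ j ih =>
      rintro k hk _ ⟨x, hx, _, ⟨y, hy, rfl⟩, rfl⟩
      exact ⟨g * x * g⁻¹, ih k hk x hx, _, ⟨_, hy (by omega), rfl⟩, by simp [mul_assoc]⟩
  obtain ⟨j, hj⟩ := mem_iUnion.1 (hWV hx)
  exact mem_iUnion.2 ⟨j, key j m le_rfl x hj⟩

/-! ### Consequences of (GC): neighbourhoods of the identity, traces, compact sets. -/

theorem GC.exists_inv {T : GroupTower G} (hGC : T.GC) {U : ∀ n, Set (T.H n)}
    (hU : T.IsSymmNhdSeq U) :
    ∃ V, T.IsSymmNhdSeq V ∧ (plusSet V 0)⁻¹ ⊆ plusSet U 0 := by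
  obtain ⟨V, hV, h⟩ := hGC U hU 0
  exact ⟨V, hV, fun x hx => h ⟨x, hx, 1, one_mem_plusSet hV.one_mem 0, mul_one x⟩⟩

theorem GC.exists_mul {T : GroupTower G} (hGC : T.GC) {U : ∀ n, Set (T.H n)}
    (hU : T.IsSymmNhdSeq U) :
    ∃ V, T.IsSymmNhdSeq V ∧ plusSet V 0 * plusSet V 0 ⊆ plusSet U 0 := by
  obtain ⟨W, hW, hWU⟩ := hGC U hU 0
  obtain ⟨V, hV, hVW⟩ := hGC.exists_inv hW
  -- The left factor lies in the inverse of `plusSet W 0` by the choice of `V`, the right one in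
  -- `plusSet W 0`, so the product lies in `bambooShoot W 0`.
  refine ⟨_, hV.inter hW, ?_⟩
  refine (mul_subset_mul ?_ (plusSet_mono fun n _ => inter_subset_right)).trans hWU
  intro x hx
  exact hVW (by simpa using plusSet_mono (fun n _ => inter_subset_left) hx)

/-- Under the Group Condition the sets `plusSet U 0` form a group filter basis. -/
@[reducible]
def GC.filterBasis {T : GroupTower G} (hGC : T.GC) : GroupFilterBasis G where
  sets := {s | ∃ U, T.IsSymmNhdSeq U ∧ s = plusSet U 0}
  nonempty := ⟨_, _, isSymmNhdSeq_univ, rfl⟩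
  inter_sets := by
    rintro _ _ ⟨U, hU, rfl⟩ ⟨V, hV, rfl⟩
    exact ⟨_, ⟨_, hU.inter hV, rfl⟩, subset_inter (plusSet_mono fun _ _ => inter_subset_left)
      (plusSet_mono fun _ _ => inter_subset_right)⟩
  one' := by
    rintro _ ⟨U, hU, rfl⟩
    exact one_mem_plusSet hU.one_mem 0
  mul' := by
    rintro _ ⟨U, hU, rfl⟩
    obtain ⟨V, hV, h⟩ := hGC.exists_mul hU
    exact ⟨_, ⟨V, hV, rfl⟩, h⟩
  inv' := by
    rintro _ ⟨U, hU, rfl⟩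
    obtain ⟨V, hV, h⟩ := hGC.exists_inv hU
    exact ⟨_, ⟨V, hV, rfl⟩, fun x hx => h (by simpa using hx)⟩
  conj' := by
    rintro g _ ⟨U, hU, rfl⟩
    obtain ⟨V, hV, h⟩ := exists_conj_plusSet_subset hU g
    exact ⟨_, ⟨V, hV, rfl⟩, h⟩

theorem GC.plusSet_mem_nhds {T : GroupTower G} (hGC : T.GC) {U : ∀ n, Set (T.H n)}
    (hU : T.IsSymmNhdSeq U) : plusSet U 0 ∈ @nhds G T.grTopology 1 := by
  have hle : T.grTopology ≤ hGC.filterBasis.topology := by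
    refine T.isLeast_grTopology.2 ⟨hGC.filterBasis.isTopologicalGroup, fun n => ?_⟩
    let := hGC.filterBasis.topology
    have := hGC.filterBasis.isTopologicalGroup
    refine continuous_of_continuousAt_one (T.H n).subtype ?_
    rw [ContinuousAt, map_one, hGC.filterBasis.nhds_one_hasBasis.tendsto_right_iff]
    rintro _ ⟨V, hV, rfl⟩
    obtain ⟨W, hW, hWV⟩ := exists_plusSet_zero_subset hV n
    filter_upwards [hV.mem_nhds n] with x hx
    exact plusSet_subset_zero hV.one_mem n (image_subset_plusSet V n ⟨x, hx, rfl⟩)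
  exact nhds_mono hle (hGC.filterBasis.mem_nhds_one ⟨U, hU, rfl⟩)

/-- The traces of `plusSet U n` on the `n`-th groups can be made arbitrarily small. -/
theorem exists_plusSet_trace_subset {Q : ∀ n, Set (T.H n)} (hQ : ∀ n, Q n ∈ 𝓝 1) :
    ∃ U, T.IsSymmNhdSeq U ∧ ∀ n (x : T.H n), (x : G) ∈ plusSet U n → x ∈ Q n := by
  have step : ∀ n (V : Set (T.H n)), V ∈ 𝓝 1 → ∃ V' : Set (T.H (n + 1)),
      (IsOpen V' ∧ 1 ∈ V' ∧ V'⁻¹ = V') ∧ V' * V' ⊆ Q (n + 1) ∧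
      Subgroup.inclusion (T.le_succ n) ⁻¹' (V' * V') ⊆ V := by
    intro n V hV
    rw [(T.isEmbedding_inclusion n).nhds_eq_comap, map_one] at hV
    obtain ⟨E, hE, hEV⟩ := hV
    obtain ⟨V', hV', h⟩ := exists_symm_mul_subset (inter_mem (hQ (n + 1)) hE)
    exact ⟨V', hV', h.trans inter_subset_left,
      (preimage_mono (h.trans inter_subset_right)).trans hEV⟩
  choose! F hF hFQ hFV using step
  obtain ⟨V₀, hV₀, hVQ₀⟩ := exists_symm_mul_subset (hQ 0)
  let U : ∀ n, Set (T.H n) := fun n => Nat.rec V₀ (fun n V => F n V) n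
  have hU : T.IsSymmNhdSeq U := by
    intro n
    induction n with
    | zero => exact hV₀
    | succ n ih => exact hF n (U n) (ih.1.mem_nhds ih.2.1)
  have hUQ : ∀ n, U n * U n ⊆ Q n := by
    intro n
    cases n with
    | zero => exact hVQ₀
    | succ n => exact hFQ n _ (hU.mem_nhds n)
  have hUU : ∀ n, Subgroup.inclusion (T.le_succ n) ⁻¹' (U (n + 1) * U (n + 1)) ⊆ U n :=
    fun n => hFV n _ (hU.mem_nhds n)
  -- Products collapse from the right: once the first factor `y` is cancelled, the rest lies in `U
  -- (n + 1)` by induction, so `x` is in the trace of `U (n + 1) * U (n + 1)` on `H n`, hence in `U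
  -- n`.
  have key : ∀ j n (x : T.H n), (x : G) ∈ partialProd U (n + 1) j → x ∈ U n := by
    intro j
    induction j with
    | zero =>
      rintro n x ⟨y, hy, hyx⟩
      refine hUU n ⟨y, hy, 1, hU.one_mem (n + 1), ?_⟩
      exact Subtype.ext (by simpa using hyx)
    | succ j ih =>
      intro n x hx
      rw [partialProd_succ'] at hx
      obtain ⟨_, ⟨y, hy, rfl⟩, r, hr, hyr⟩ := hx
      have e : y⁻¹ * Subgroup.inclusion (T.le_succ n) x ∈ U (n + 1) := by
        refine ih (n + 1) _ ?_
        convert hr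
        simp [← hyr]
      exact hUU n ⟨y, hy, _, e, by simp⟩
  refine ⟨U, hU, fun n x hx => ?_⟩
  rw [plusSet_eq hU.one_mem] at hx
  obtain ⟨_, ⟨y, hy, rfl⟩, r, hr, hyr⟩ := hx
  obtain ⟨j, hj⟩ := mem_iUnion.1 hr
  have e : y⁻¹ * x ∈ U n := by
    refine key j n _ ?_
    convert hj
    simp [← hyr]
  exact hUQ n ⟨y, hy, _, e, by simp⟩

/-- Each group of the tower is a topological subgroup of the inductive limit. -/
theorem GC.top_eq_induced {T : GroupTower G} (hGC : T.GC) (n : ℕ) :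
    T.top n = T.grTopology.induced Subtype.val := by
  let := T.grTopology
  have : IsTopologicalGroup G := T.isLeast_grTopology.1.1
  have hc : @Continuous (T.H n) G (T.top n) _ Subtype.val := T.isLeast_grTopology.1.2 n
  have : @IsInducing _ _ (T.top n) _ (T.H n).subtype := by
    rw [IsTopologicalGroup.isInducing_iff_nhds_one]
    apply le_antisymm
    · have := hc.tendsto 1
      exact this.le_comap
    · intro W hW
      classical
      obtain ⟨U, hU, hUW⟩ := exists_plusSet_trace_subset (T := T)
        (Q := Function.update (fun _ => univ) n W) (fun k => by
          rcases eq_or_ne k n with rfl | h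
          · simpa using hW
          · simp [h])
      obtain ⟨V, hV, hVU⟩ := exists_plusSet_zero_subset hU n
      refine ⟨plusSet V 0, hGC.plusSet_mem_nhds hV, fun x hx => ?_⟩
      simpa using hUW n x (hVU hx)
  exact this.eq_induced

/-- The element `h` is the inverse of the product of the factors of `g` from `U 0, …, U p`. -/
theorem exists_mul_mem_plusSet {U : ∀ n, Set (T.H n)} (hU : ∀ n, 1 ∈ U n) {g : G}
    (hg : g ∈ plusSet U 0) (p : ℕ) : ∃ h ∈ T.H p, h * g ∈ plusSet U (p + 1) := by
  induction p with
  | zero =>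
    rw [plusSet_eq hU] at hg
    obtain ⟨_, ⟨y, hy, rfl⟩, r, hr, rfl⟩ := hg
    exact ⟨(y : G)⁻¹, inv_mem y.2, by simpa using hr⟩
  | succ p ih =>
    obtain ⟨h, hh, hg⟩ := ih
    rw [plusSet_eq hU] at hg
    obtain ⟨_, ⟨y, hy, rfl⟩, r, hr, hyr⟩ := hg
    refine ⟨(y : G)⁻¹ * h, mul_mem (inv_mem y.2) (T.le_succ p hh), ?_⟩
    rwa [mul_assoc, ← hyr, inv_mul_cancel_left]

/-- Compact sets of the inductive limit of a closed tower are contained in its groups. -/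
theorem GC.exists_subset_of_isCompact {T : GroupTower G} (hGC : T.GC) (hcl : T.IsClosedTower)
    {C : Set G} (hC : @IsCompact G T.grTopology C) : ∃ n, C ⊆ T.H n := by
  let := T.grTopology
  have : IsTopologicalGroup G := T.isLeast_grTopology.1.1
  by_contra! hn
  have hex : ∀ p, ∃ g : G, (∃ x ∈ C, x ∈ T.H (p + 1) ∧ x ∉ T.H p) →
      g ∈ C ∧ g ∈ T.H (p + 1) ∧ g ∉ T.H p := by
    intro p
    by_cases h : ∃ x ∈ C, x ∈ T.H (p + 1) ∧ x ∉ T.H p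
    · obtain ⟨x, hx⟩ := h
      exact ⟨x, fun _ => hx⟩
    · exact ⟨1, fun h' => absurd h' h⟩
  choose g hg using hex
  -- `Q (p + 1)` is a neighbourhood of 1 because `g p ∉ H p` and `H p` is closed in `H (p + 1)`. The
  -- guard makes it everything when `C` has no point in `H (p + 1)` outside `H p`.
  let Q : ∀ n, Set (T.H n) := fun n => match n with
    | 0 => univ
    | p + 1 => {x | (∃ x ∈ C, x ∈ T.H (p + 1) ∧ x ∉ T.H p) → (x : G) * (g p)⁻¹ ∉ T.H p}
  have hQ : ∀ n, Q n ∈ 𝓝 1 := by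
    intro n
    cases n with
    | zero => exact univ_mem
    | succ p =>
      by_cases h : ∃ x ∈ C, x ∈ T.H (p + 1) ∧ x ∉ T.H p
      · obtain ⟨hgC, hg₁, hg₂⟩ := hg p h
        have hc : Continuous fun x : T.H (p + 1) => x * (⟨g p, hg₁⟩ : T.H (p + 1))⁻¹ := by
          fun_prop
        filter_upwards [((hcl p).isOpen_compl.preimage hc).mem_nhds (x := 1) (by
          rintro ⟨y, hy⟩
          apply hg₂
          have : (y : G) = 1 * (g p)⁻¹ := congrArg Subtype.val hy
          rw [one_mul] at this
          exact inv_mem_iff.1 (this ▸ y.2))] with x hx _ hx'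
        exact hx ⟨⟨_, hx'⟩, rfl⟩
      · exact Filter.mem_of_superset univ_mem fun x _ h' => absurd h' h
  obtain ⟨U, hU, hUQ⟩ := exists_plusSet_trace_subset hQ
  obtain ⟨t, -, htC⟩ := hC.elim_nhds_subcover (fun x => x • plusSet U 0) fun x _ => by
    simpa using smul_mem_nhds_smul x (hGC.plusSet_mem_nhds hU)
  have ht : ∃ m, ∀ f ∈ t, f ∈ T.H m := by
    choose k hk using T.exhaust
    exact ⟨t.sup k, fun f hf => T.monotone_H (Finset.le_sup hf) (hk f)⟩
  obtain ⟨m, hm⟩ := ht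
  obtain ⟨x, hxC, hxm⟩ := not_subset.1 (hn m)
  classical
  have hx := T.exhaust x
  have hlt : m < Nat.find hx := by
    by_contra! h
    exact hxm (T.monotone_H h (Nat.find_spec hx))
  obtain ⟨p, hp⟩ : ∃ p, Nat.find hx = p + 1 := ⟨Nat.find hx - 1, by omega⟩
  have hP : ∃ x ∈ C, x ∈ T.H (p + 1) ∧ x ∉ T.H p :=
    ⟨x, hxC, hp ▸ Nat.find_spec hx, Nat.find_min hx (by omega)⟩
  obtain ⟨hgC, hg₁, hg₂⟩ := hg p hP
  obtain ⟨f, hft, u, hu, hfu⟩ : ∃ f ∈ t, ∃ u ∈ plusSet U 0, f * u = g p := by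
    simpa [mem_smul_set] using htC hgC
  -- Since `m ≤ p`, the centre `f` lies in `H p`, and so does `h * f⁻¹`, the quotient of `h * u` by
  -- `g p`; this is what `Q (p + 1)` forbids.
  have hf : f ∈ T.H p := T.monotone_H (by omega) (hm f hft)
  obtain ⟨h, hh, hhu⟩ := exists_mul_mem_plusSet hU.one_mem hu p
  have hu' : h * u = h * f⁻¹ * g p := by rw [← hfu]; group
  have hy : h * u ∈ T.H (p + 1) := by
    rw [hu']
    exact mul_mem (T.le_succ p (mul_mem hh (inv_mem hf))) hg₁
  refine hUQ (p + 1) ⟨h * u, hy⟩ hhu hP ?_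
  simpa [hu'] using mul_mem hh (inv_mem hf)

end GroupTower

/-! ### Ascoli spaces. -/

section Ascoli

variable {X : Type u} [TopologicalSpace X]

/-- Sequential Tychonoff spaces are Ascoli spaces. -/
theorem isAscoliSpace_of_sequentialSpace [T35Space X] [SequentialSpace X] : IsAscoliSpace X := by
  refine ⟨inferInstance, fun K hK => ?_⟩
  rw [equicontinuous_iff_continuous]
  refine SeqContinuous.continuous fun x a hx => ?_
  let S : Set X := insert a (range x)
  have : CompactSpace S := isCompact_iff_compactSpace.1 hx.isCompact_insert_range
  have : CompactSpace K := isCompact_iff_compactSpace.1 hK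
  -- Evaluation is jointly continuous because `S` is compact; currying it turns convergence in `S`
  -- into uniform convergence over `K`.
  let ev : C(S × K, ℝ) :=
    ⟨fun p => (p.2 : C(X, ℝ)).restrict S p.1, by
      have h : Continuous fun p : S × K => ((p.2 : C(X, ℝ)).restrict S, p.1) :=
        ((ContinuousMap.continuous_restrict S).comp
          (continuous_subtype_val.comp continuous_snd)).prodMk continuous_fst
      exact ContinuousEval.continuous_eval.comp h⟩
  have hxS : ∀ n, x n ∈ S := fun n => mem_insert_of_mem _ ⟨n, rfl⟩
  have hlim : Tendsto (fun n => (⟨x n, hxS n⟩ : S)) atTop (𝓝 ⟨a, mem_insert _ _⟩) :=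
    tendsto_subtype_rng.2 hx
  have := ContinuousMap.tendsto_iff_tendstoUniformly.1 ((ev.curry.continuous.tendsto _).comp hlim)
  rw [UniformFun.tendsto_iff_tendstoUniformly]
  exact this

/-- A space is not Ascoli if some point is an accumulation point of a family of points that has a
family of open neighbourhoods of which every compact set meets only finitely many. -/
theorem not_isAscoliSpace_of_compact_finite {ι : Type*} (a : ι → X) (U : ι → Set X)
    (hU : ∀ i, IsOpen (U i)) (haU : ∀ i, a i ∈ U i)
    (hfin : ∀ C : Set X, IsCompact C → {i | (C ∩ U i).Nonempty}.Finite) (z : X)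
    (hz : ∀ O ∈ 𝓝 z, {i | a i ∈ O}.Infinite) : ¬ IsAscoliSpace X := by
  rintro ⟨hX, hA⟩
  -- Bump functions at `a i` vanishing off `U i`. On a given compact set almost all of them vanish,
  -- so together with 0 they form a compact set.
  have hf : ∀ i, ∃ f : C(X, ℝ), f (a i) = 1 ∧ ∀ x ∉ U i, f x = 0 := by
    intro i
    obtain ⟨f, hf, h0, h1⟩ := CompletelyRegularSpace.completely_regular (a i) (U i)ᶜ
      (hU i).isClosed_compl (by simpa using haU i)
    refine ⟨⟨fun x => 1 - (f x : ℝ), by fun_prop⟩, by simp [h0], fun x hx => ?_⟩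
    have := h1 hx
    simp [this]
  choose f hfa hfU using hf
  have hlim : Tendsto f cofinite (𝓝 0) := by
    rw [ContinuousMap.tendsto_iff_forall_isCompact_tendstoUniformlyOn]
    intro C hC
    rw [Metric.tendstoUniformlyOn_iff]
    intro ε hε
    filter_upwards [(hfin C hC).compl_mem_cofinite] with i hi x hx
    have : f i x = 0 := hfU i x fun h => hi ⟨x, hx, h⟩
    simpa [this] using hε
  have hK := hA _ hlim.isCompact_insert_range_of_cofinite
  have hE := Metric.equicontinuousAt_iff_right.1 (hK z) 1 one_pos
  have hzf : {i | z ∈ U i}.Finite :=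
    (hfin {z} isCompact_singleton).subset fun i hi => ⟨z, rfl, hi⟩
  obtain ⟨i, hi, hiz⟩ := ((hz _ hE).sdiff hzf).nonempty
  have h := hi ⟨f i, mem_insert_of_mem _ ⟨i, rfl⟩⟩
  have hz0 : f i z = 0 := hfU i z hiz
  simp [hfa, hz0] at h

end Ascoli

/-! ### Increasing subgroups: open steps. -/

section IncreasingSubgroups

variable {G : Type u} [Group G] {H : ℕ → Subgroup G}

/-- The products of the sets `W 0, …, W n`. -/
def initialProd (W : ℕ → Set G) : ℕ → Set G
  | 0 => W 0
  | n + 1 => initialProd W n * W (n + 1)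

theorem initialProd_subset (S : Subgroup G) {W : ℕ → Set G} (h : ∀ n, W n ⊆ S) (n : ℕ) :
    initialProd W n ⊆ S := by
  induction n with
  | zero => exact h 0
  | succ n ih =>
    rintro _ ⟨x, hx, y, hy, rfl⟩
    exact mul_mem (ih hx) (h _ hy)

variable [TopologicalSpace G]

/-- If the `k`-th step is open for all `k ≥ m`, then the `m`-th group is relatively a
neighbourhood of the identity in all later ones. -/
theorem mem_nhdsWithin_of_forall_step {m : ℕ}
    (h : ∀ n ≥ m, (H n : Set G) ∈ 𝓝[H (n + 1)] 1) {n : ℕ} (hn : m ≤ n) :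
    (H m : Set G) ∈ 𝓝[H n] 1 := by
  induction n, hn using Nat.le_induction with
  | base => exact self_mem_nhdsWithin
  | succ n hn ih => exact nhdsWithin_le_of_mem (h n hn) ih

/-- The products `W 0 * ⋯ * W n` of relative neighbourhoods of the identity unite to a
neighbourhood of the identity. -/
def HasProductNhds (H : ℕ → Subgroup G) : Prop :=
  ∀ W : ℕ → Set G, (∀ n, W n ∈ 𝓝[H n] 1) → (⋃ n, initialProd W n) ∈ 𝓝 1

variable [IsTopologicalGroup G]

/-- The sets `H m ∩ H n` are admissible factors, and their products never leave `H m`. -/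
theorem isOpen_of_forall_step (hmono : Monotone H) (hprod : HasProductNhds H) {m : ℕ}
    (h : ∀ n ≥ m, (H n : Set G) ∈ 𝓝[H (n + 1)] 1) : IsOpen (H m : Set G) := by
  refine (H m).isOpen_of_mem_nhds (g := 1) ?_
  refine mem_of_superset (hprod (fun n => H m ∩ H n) fun n => ?_)
    (iUnion_subset (initialProd_subset (H m) fun n => inter_subset_left))
  rcases le_total n m with hn | hn
  · exact mem_of_superset self_mem_nhdsWithin (subset_inter (hmono hn) Subset.rfl)
  · exact inter_mem (mem_nhdsWithin_of_forall_step h hn) self_mem_nhdsWithin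

/-- A Hausdorff group is metrizable once it is first countable at the identity, and this can be read
off from an open subgroup. -/
theorem metrizableSpace_of_isOpen_subgroup [T2Space G] (S : Subgroup G) (hS : IsOpen (S : Set G))
    [TopologicalSpace.MetrizableSpace S] : TopologicalSpace.MetrizableSpace G := by
  have h1 : (𝓝 (1 : G)).IsCountablyGenerated := by
    have : map (Subtype.val : S → G) (𝓝 1) = 𝓝 1 :=
      hS.isOpenEmbedding_subtypeVal.map_nhds_eq 1
    rw [← this]
    infer_instance
  let := IsTopologicalGroup.rightUniformSpace G
  have : (uniformity G).IsCountablyGenerated := by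
    rw [uniformity_eq_comap_nhds_one']
    infer_instance
  exact UniformSpace.metrizableSpace

theorem isOpen_of_isOpen_preimage_of_isOpen_subgroup (hmono : Monotone H) (hex : ∀ g, ∃ n, g ∈ H n)
    {m : ℕ} (hm : IsOpen (H m : Set G)) {O : Set G}
    (hO : ∀ n, IsOpen (Subtype.val ⁻¹' O : Set (H n))) : IsOpen O := by
  rw [isOpen_iff_mem_nhds]
  intro g hg
  obtain ⟨n, hn⟩ := hex g
  have hN : IsOpen (H (max m n) : Set G) := Subgroup.isOpen_mono (hmono (le_max_left m n)) hm
  have := hN.isOpenMap_subtype_val _ (hO (max m n))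
  exact mem_of_superset (this.mem_nhds ⟨⟨g, hmono (le_max_right m n) hn⟩, hg, rfl⟩)
    (image_preimage_subset _ _)

end IncreasingSubgroups

/-! ### Increasing subgroups: locally compact groups. -/

section IncreasingSubgroups

variable {G : Type u} [Group G] [TopologicalSpace G] [IsTopologicalGroup G] {H : ℕ → Subgroup G}

/-- The inductive step for compact products inside `O`: compactness of `P` yields one neighbourhood
of 1 that serves all its points, and local compactness of `S` shrinks it to a compact one. -/
theorem exists_isCompact_mul_subset (S : Subgroup G) [LocallyCompactSpace S] {P O : Set G}
    (hP : IsCompact P) (hPS : P ⊆ S) (hPO : P ⊆ O) (hO : IsOpen (Subtype.val ⁻¹' O : Set S)) :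
    ∃ K : Set G, IsCompact K ∧ K ⊆ S ∧ K ∈ 𝓝[S] 1 ∧ P * K ⊆ O := by
  obtain ⟨O', hO', hOO'⟩ := isOpen_induced_iff.1 hO
  have hmem : ∀ x ∈ S, x ∈ O' ↔ x ∈ O := fun x hx =>
    show (⟨x, hx⟩ : S) ∈ Subtype.val ⁻¹' O' ↔ (⟨x, hx⟩ : S) ∈ Subtype.val ⁻¹' O by rw [hOO']
  obtain ⟨V, hV, hPV⟩ := compact_open_separated_mul_right hP hO'
    fun x hx => (hmem x (hPS hx)).2 (hPO hx)
  have hV' : (Subtype.val ⁻¹' V : Set S) ∈ 𝓝 1 := continuous_subtype_val.continuousAt hV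
  obtain ⟨K, hK, hKV, hKc⟩ := local_compact_nhds hV'
  have hKS : Subtype.val '' K ⊆ (S : Set G) := by rintro _ ⟨x, -, rfl⟩; exact x.2
  refine ⟨Subtype.val '' K, hKc.image continuous_subtype_val, hKS, ?_, ?_⟩
  · rw [nhdsWithin_eq_map_subtype_coe S.one_mem]
    exact image_mem_map hK
  · rintro _ ⟨p, hp, _, ⟨x, hx, rfl⟩, rfl⟩
    exact (hmem _ (mul_mem (hPS hp) x.2)).1 (hPV ⟨p, hp, x, hKV hx, rfl⟩)

/-- In a union of locally compact subgroups with the topology given by `HasProductNhds`, every set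
with open traces is open. -/
theorem isOpen_of_isOpen_preimage_of_locallyCompact (hmono : Monotone H)
    (hex : ∀ g, ∃ n, g ∈ H n) (hprod : HasProductNhds H) (hlc : ∀ n, LocallyCompactSpace (H n))
    {O : Set G} (hO : ∀ n, IsOpen (Subtype.val ⁻¹' O : Set (H n))) : IsOpen O := by
  have main : ∀ O : Set G, (∀ n, IsOpen (Subtype.val ⁻¹' O : Set (H n))) → 1 ∈ O → O ∈ 𝓝 1 := by
    intro O hO h1
    have step : ∀ n (P : Set G), (IsCompact P ∧ P ⊆ H n ∧ P ⊆ O) →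
        ∃ K : Set G, K ∈ 𝓝[H (n + 1)] 1 ∧ IsCompact (P * K) ∧ P * K ⊆ H (n + 1) ∧ P * K ⊆ O := by
      rintro n P ⟨hP, hPH, hPO⟩
      have hPH' : P ⊆ H (n + 1) := hPH.trans (hmono n.le_succ)
      obtain ⟨K, hK, hKH, hK1, hPK⟩ := exists_isCompact_mul_subset (H (n + 1)) hP hPH' hPO (hO _)
      refine ⟨K, hK1, hP.mul hK, ?_, hPK⟩
      rintro _ ⟨p, hp, x, hx, rfl⟩
      exact mul_mem (hPH' hp) (hKH hx)
    choose! F hF1 hF using step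
    obtain ⟨K₀, hK₀, hKH₀, hK₀1, hK₀O⟩ := exists_isCompact_mul_subset (H 0) (P := {1})
      isCompact_singleton (by simp) (by simpa using h1) (hO 0)
    rw [singleton_mul, image_congr fun x _ => one_mul x, image_id'] at hK₀O
    let P : ℕ → Set G := fun n => Nat.rec K₀ (fun n P => P * F n P) n
    have hP : ∀ n, IsCompact (P n) ∧ P n ⊆ H n ∧ P n ⊆ O := by
      intro n
      induction n with
      | zero => exact ⟨hK₀, hKH₀, hK₀O⟩
      | succ n ih => exact hF n (P n) ih
    let K : ℕ → Set G := fun n => match n with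
      | 0 => K₀
      | n + 1 => F n (P n)
    have hKP : ∀ n, initialProd K n = P n := by
      intro n
      induction n with
      | zero => rfl
      | succ n ih => rw [initialProd, ih]
    refine mem_of_superset (hprod K fun n => ?_) (iUnion_subset fun n => (hKP n).trans_subset
      (hP n).2.2)
    cases n with
    | zero => exact hK₀1
    | succ n => exact hF1 n (P n) (hP n)
  rw [isOpen_iff_mem_nhds]
  intro g hg
  have hg' : (fun x => g * x) ⁻¹' O ∈ 𝓝 1 := by
    refine main _ (fun n => ?_) (by simpa using hg)
    obtain ⟨m, hm⟩ := hex g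
    let N := max m n
    let γ : H N := ⟨g, hmono (le_max_left m n) hm⟩
    have hc : Continuous fun x : H n => γ * Subgroup.inclusion (hmono (le_max_right m n)) x :=
      continuous_const.mul (continuous_subtype_val.subtype_mk _)
    exact (hO N).preimage hc
  have := (continuous_const_mul g⁻¹).tendsto g
  rw [inv_mul_cancel] at this
  filter_upwards [this hg'] with x hx
  simpa using hx

theorem hasOpenMKOmegaSubgroup_of_locallyCompact (hmono : Monotone H)
    (hex : ∀ g, ∃ n, g ∈ H n) (hprod : HasProductNhds H) (hlc : ∀ n, LocallyCompactSpace (H n))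
    (hmet : ∀ n, TopologicalSpace.MetrizableSpace (H n)) : HasOpenMKOmegaSubgroup G := by
  have hK : ∀ n, ∃ K : Set G, IsCompact K ∧ K ⊆ H n ∧ K ∈ 𝓝[H n] 1 := by
    intro n
    obtain ⟨K, h1, h2, h3, -⟩ := exists_isCompact_mul_subset (H n) (P := {1}) (O := univ)
      isCompact_singleton (by simp) (subset_univ _) (by simp)
    exact ⟨K, h1, h2, h3⟩
  choose K hKc hKH hK1 using hK
  -- Including 1 makes the powers `D n ^ n` increase; including inverses makes their union a
  -- subgroup.
  let D : ℕ → Set G := fun n => insert 1 (⋃ i ∈ Finset.range (n + 1), (K i ∪ (K i)⁻¹))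
  have hD1 : ∀ n, 1 ∈ D n := fun n => mem_insert _ _
  have hDmono : Monotone D := fun m n h => insert_subset_insert
    (biUnion_mono (fun i hi => by simp at hi ⊢; omega) fun _ _ => Subset.rfl)
  have hDc : ∀ n, IsCompact (D n) := fun n =>
    ((Finset.range (n + 1)).isCompact_biUnion fun i _ => (hKc i).union (hKc i).inv).insert 1
  have hDinv : ∀ n, (D n)⁻¹ = D n := by
    intro n
    simp only [D, inv_insert, inv_one, iUnion_inv, union_inv, inv_inv, union_comm]
  have hKD : ∀ n, K n ⊆ D n := fun n x hx => mem_insert_of_mem _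
    (mem_biUnion (x := n) (by simp) (Or.inl hx))
  have hDH : ∀ n, D n ⊆ H n := by
    intro n
    refine insert_subset (one_mem _) (iUnion₂_subset fun i hi => ?_)
    have : (H i : Set G) ⊆ H n := hmono (by simp at hi; omega)
    refine union_subset ((hKH i).trans this) fun x hx => ?_
    exact inv_mem_iff.1 (this (hKH i hx))
  have hpow : ∀ {m n a b : ℕ}, m ≤ n → a ≤ b → D m ^ a ⊆ D n ^ b := fun h h' =>
    (pow_subset_pow_left (hDmono h)).trans (pow_subset_pow_right (hD1 _) h')
  let S : Subgroup G :=
    { carrier := ⋃ n, D n ^ n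
      one_mem' := mem_iUnion.2 ⟨0, by simp⟩
      mul_mem' := by
        intro x y hx hy
        obtain ⟨a, ha⟩ := mem_iUnion.1 hx
        obtain ⟨b, hb⟩ := mem_iUnion.1 hy
        refine mem_iUnion.2 ⟨a + b, ?_⟩
        rw [pow_add]
        exact mul_mem_mul (hpow (by omega) le_rfl ha) (hpow (by omega) le_rfl hb)
      inv_mem' := by
        intro x hx
        obtain ⟨a, ha⟩ := mem_iUnion.1 hx
        refine mem_iUnion.2 ⟨a, ?_⟩
        rw [← hDinv, inv_pow]
        simpa using ha }
  have hDS : ∀ n, D n ^ n ⊆ S := fun n => subset_iUnion (fun n => D n ^ n) n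
  have hKS : ∀ n, K n ⊆ S := by
    intro n
    refine ((hKD n).trans ?_).trans (hDS (n + 1))
    conv_lhs => rw [← pow_one (D n)]
    exact hpow (by omega) (by omega)
  have hDnH : ∀ n, D n ^ n ⊆ H n := by
    intro n x hx
    have : ∀ k, D n ^ k ⊆ H n := by
      intro k
      induction k with
      | zero => simp
      | succ k ih =>
        rw [pow_succ]
        rintro _ ⟨x, hx, y, hy, rfl⟩
        exact mul_mem (ih hx) (hDH n hy)
    exact this n hx
  refine ⟨S, S.isOpen_of_mem_nhds (g := 1) (mem_of_superset (hprod K hK1)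
    (iUnion_subset (initialProd_subset S hKS))), fun n => Subtype.val ⁻¹' (D n ^ n), ?_, ?_, ?_,
    ?_, ?_⟩
  · exact fun m n h => preimage_mono (hpow h h)
  · intro n
    refine (IsInducing.subtypeVal.isCompact_preimage_iff ?_).2 ?_
    · simpa using hDS n
    · have : ∀ k, IsCompact (D n ^ k) := by
        intro k
        induction k with
        | zero => simp
        | succ k ih => exact pow_succ (D n) k ▸ ih.mul (hDc n)
      exact this n
  · intro n
    have := hmet n
    let f : (Subtype.val ⁻¹' (D n ^ n) : Set S) → H n := fun x => ⟨x.1.1, hDnH n x.2⟩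
    have hf : IsEmbedding f := by
      have hf : Continuous f :=
        (continuous_subtype_val.comp continuous_subtype_val).subtype_mk _
      have hv : IsEmbedding fun x : (Subtype.val ⁻¹' (D n ^ n) : Set S) => (x.1.1 : G) :=
        IsEmbedding.subtypeVal.comp IsEmbedding.subtypeVal
      exact IsEmbedding.of_comp hf continuous_subtype_val hv
    exact hf.metrizableSpace
  · refine eq_univ_of_forall fun x => ?_
    obtain ⟨n, hn⟩ := mem_iUnion.1 (show (x : G) ∈ ⋃ n, D n ^ n from x.2)
    exact mem_iUnion.2 ⟨n, hn⟩
  · refine fun s => ⟨fun hs n => hs.preimage continuous_subtype_val, fun hs => ?_⟩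
    suffices h : IsOpen (Subtype.val '' s : Set G) by
      simpa [preimage_image_eq s Subtype.val_injective] using
        h.preimage (continuous_subtype_val (p := (· ∈ S)))
    refine isOpen_of_isOpen_preimage_of_locallyCompact hmono hex hprod hlc fun n => ?_
    rw [isOpen_iff_mem_nhds]
    rintro ⟨x, hx⟩ ⟨y, hys, hyx : (y : G) = x⟩
    obtain ⟨m, hm⟩ := mem_iUnion.1 (show (y : G) ∈ ⋃ n, D n ^ n from y.2)
    let N := max m n
    have hy : (y : G) ∈ D N ^ N := hpow (le_max_left m n) (le_max_left m n) hm
    -- The index is `N + 1` because points of `H n` near `x` are `x` times one more factor, from `K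
    -- n ⊆ D (N + 1)`.
    obtain ⟨O, hO, hOs⟩ := isOpen_induced_iff.1 (hs (N + 1))
    obtain ⟨O', hO', rfl⟩ := isOpen_induced_iff.1 hO
    have hmem : ∀ z (hz : z ∈ D (N + 1) ^ (N + 1)), z ∈ O' → z ∈ Subtype.val '' s := by
      intro z hz hzO
      refine ⟨⟨z, hDS _ hz⟩, ?_, rfl⟩
      have : (⟨⟨z, hDS _ hz⟩, hz⟩ : (Subtype.val ⁻¹' (D (N + 1) ^ (N + 1)) : Set S)) ∈
        Subtype.val ⁻¹' s := hOs ▸ hzO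
      exact this
    have hyO : (y : G) ∈ O' := by
      have : (⟨y, hpow (by omega) (by omega) hy⟩ :
        (Subtype.val ⁻¹' (D (N + 1) ^ (N + 1)) : Set S)) ∈ Subtype.val ⁻¹' s := hys
      rw [← hOs] at this
      exact this
    have h1 : (fun z : H n => (x⁻¹ * z : G)) ⁻¹' K n ∈ 𝓝 ⟨x, hx⟩ := by
      have hc : Continuous fun z : H n => (⟨x, hx⟩ : H n)⁻¹ * z := by fun_prop
      have h2 : (Subtype.val ⁻¹' K n : Set (H n)) ∈ 𝓝 1 := by
        have h := hK1 n
        rw [nhdsWithin_eq_map_subtype_coe (H n).one_mem] at h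
        exact h
      have h3 := hc.tendsto ⟨x, hx⟩
      rw [inv_mul_cancel] at h3
      exact h3 h2
    filter_upwards [h1, (hO'.preimage continuous_subtype_val).mem_nhds
      (show (⟨x, hx⟩ : H n) ∈ Subtype.val ⁻¹' O' from hyx ▸ hyO)] with z hz hzO
    refine hmem z ?_ hzO
    have : (z : G) = x * (x⁻¹ * z) := by group
    rw [this, pow_succ]
    exact mul_mem_mul (hpow (by omega) le_rfl (hyx ▸ hy))
      (hDmono ((le_max_right m n).trans (Nat.le_succ _)) (hKD n hz))

end IncreasingSubgroups

/-! ### Double sequences against the Fréchet–Urysohn and Ascoli properties. -/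

section IncreasingSubgroups

variable {G : Type u} [Group G] [TopologicalSpace G] {H : ℕ → Subgroup G}

theorem isCountablyGenerated_nhdsWithin_one (S : Subgroup G) [TopologicalSpace.MetrizableSpace S] :
    (𝓝[S] (1 : G)).IsCountablyGenerated := by
  rw [nhdsWithin_eq_map_subtype_coe S.one_mem]
  infer_instance

theorem exists_seq_of_not_mem_nhdsWithin {A S : Subgroup G} [TopologicalSpace.MetrizableSpace S]
    (h : (A : Set G) ∉ 𝓝[S] 1) :
    ∃ y : ℕ → G, (∀ i, y i ∈ S ∧ y i ∉ A) ∧ Tendsto y atTop (𝓝 1) := by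
  have := isCountablyGenerated_nhdsWithin_one S
  have hf : ∃ᶠ x in 𝓝[S] (1 : G), x ∈ S ∧ x ∉ A := by
    refine (Frequently.and_eventually ?_ self_mem_nhdsWithin).mono fun x hx => ⟨hx.2, hx.1⟩
    exact fun h' => h (mem_of_superset h' fun x hx => not_not.1 hx)
  obtain ⟨y, hy, hy'⟩ := exists_seq_forall_of_frequently hf
  exact ⟨y, hy', hy.mono_right nhdsWithin_le_nhds⟩

/-- There is a sequence of neighbourhoods of the identity that shrinks to it on every group of the
sequence. -/
theorem exists_shrinking_nhds (hmet : ∀ n, TopologicalSpace.MetrizableSpace (H n)) :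
    ∃ P : ℕ → Set G, (∀ i, IsOpen (P i) ∧ 1 ∈ P i) ∧
      ∀ n, ∀ W ∈ 𝓝 (1 : G), ∀ᶠ i in atTop, P i ∩ H n ⊆ W := by
  have hb : ∀ n, ∃ O : ℕ → Set G, (∀ b, IsOpen (O b) ∧ 1 ∈ O b) ∧
      ∀ W ∈ 𝓝 (1 : G), ∃ b, O b ∩ H n ⊆ W := by
    intro n
    have := isCountablyGenerated_nhdsWithin_one (H n)
    obtain ⟨B, hB⟩ := (𝓝[H n] (1 : G)).exists_antitone_basis
    choose O hO hO1 hOB using fun b => mem_nhdsWithin.1 (hB.mem b)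
    refine ⟨O, fun b => ⟨hO b, hO1 b⟩, fun W hW => ?_⟩
    obtain ⟨b, hb⟩ := hB.mem_iff.1 (mem_nhdsWithin_of_mem_nhds hW)
    exact ⟨b, (hOB b).trans hb⟩
  choose O hO hOW using hb
  -- A diagonal intersection: each `O n b` is among the sets intersected as soon as `i ≥ max n b`.
  refine ⟨fun i => ⋂ n ∈ Finset.range (i + 1), ⋂ b ∈ Finset.range (i + 1), O n b,
    fun i => ⟨isOpen_biInter_finset fun n _ => isOpen_biInter_finset fun b _ => (hO n b).1,
      mem_iInter₂.2 fun n _ => mem_iInter₂.2 fun b _ => (hO n b).2⟩, fun n W hW => ?_⟩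
  obtain ⟨b, hb⟩ := hOW n W hW
  filter_upwards [eventually_ge_atTop (max n b)] with i hi x hx
  refine hb ⟨?_, hx.2⟩
  exact mem_iInter₂.1 (mem_iInter₂.1 hx.1 n (by simp; omega)) b (by simp; omega)

variable [IsTopologicalGroup G]

/-- The points `x i * y i k` have 1 in their closure as an iterated limit. A sequence of them
tending to 1 would lie in one `H n`, so it would use only rows `i < n`; these rows with their limits
`x i` form a closed set that misses 1. -/
theorem not_frechetUrysohnSpace_of_not_step [T2Space G] (hmono : Monotone H)
    (hmet : ∀ n, TopologicalSpace.MetrizableSpace (H n))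
    (hcpt : ∀ C : Set G, IsCompact C → ∃ n, C ⊆ H n)
    (hstep : ∀ m, ∃ n ≥ m, (H n : Set G) ∉ 𝓝[H (n + 1)] 1) : ¬ FrechetUrysohnSpace G := by
  intro hFU
  obtain ⟨m, -, hm⟩ := hstep 0
  obtain ⟨x, hx, hxlim⟩ := exists_seq_of_not_mem_nhdsWithin hm
  choose j hj hjstep using fun i => hstep (max i (m + 1))
  choose y hy hylim using fun i => exists_seq_of_not_mem_nhdsWithin (hjstep i)
  have hxj : ∀ i, x i ∈ H (j i) := fun i => hmono ((le_max_right _ _).trans (hj i)) (hx i).1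
  have hxy : ∀ i, Tendsto (fun k => x i * y i k) atTop (𝓝 (x i)) := fun i => by
    simpa using (hylim i).const_mul (x i)
  let A : Set G := ⋃ i, range fun k => x i * y i k
  have hA : (1 : G) ∈ closure A := by
    refine isClosed_closure.mem_of_tendsto hxlim (Eventually.of_forall fun i => ?_)
    exact mem_closure_of_tendsto (hxy i)
      (Eventually.of_forall fun k => mem_iUnion.2 ⟨i, k, rfl⟩)
  obtain ⟨a, ha, halim⟩ := hFU.closure_subset_seqClosure A hA
  obtain ⟨n, hn⟩ := hcpt _ halim.isCompact_insert_range
  let F : Set G := ⋃ i ∈ Finset.range n, insert (x i) (range fun k => x i * y i k)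
  have hF : IsClosed F :=
    ((Finset.range n).isCompact_biUnion fun i _ => (hxy i).isCompact_insert_range).isClosed
  have haF : ∀ l, a l ∈ F := by
    intro l
    obtain ⟨i, k, hik : x i * y i k = a l⟩ := mem_iUnion.1 (ha l)
    have hi : i < n := by
      by_contra! h
      have hal : a l ∈ H (j i) := hmono (h.trans ((le_max_left _ _).trans (hj i)))
        (hn (mem_insert_of_mem _ ⟨l, rfl⟩))
      rw [← hik] at hal
      exact (hy i k).2 (((H (j i)).mul_mem_cancel_left (hxj i)).1 hal)
    exact mem_biUnion (x := i) (by simpa using hi) (mem_insert_of_mem _ ⟨k, hik⟩)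
  have h1 : (1 : G) ∈ F := hF.mem_of_tendsto halim (Eventually.of_forall haF)
  obtain ⟨i, -, h⟩ := mem_iUnion₂.1 h1
  rcases h with h | ⟨k, hk : x i * y i k = 1⟩
  · exact (hx i).2 (h ▸ one_mem _)
  · exact (hy i k).2 (((H (j i)).mul_mem_cancel_left (hxj i)).1 (hk ▸ one_mem _))

/-- A closed neighbourhood of 1 inside `W` is not sequentially compact; being closed, it also
excludes limits elsewhere in `S`. -/
theorem exists_seq_of_not_locallyCompactSpace (S : Subgroup G) [TopologicalSpace.MetrizableSpace S]
    (hS : ¬ LocallyCompactSpace S) {W : Set G} (hW : W ∈ 𝓝 1) :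
    ∃ x : ℕ → G, (∀ i, x i ∈ S ∧ x i ∈ W) ∧
      ∀ c ∈ S, ∀ φ : ℕ → ℕ, StrictMono φ → ¬ Tendsto (x ∘ φ) atTop (𝓝 c) := by
  let := TopologicalSpace.metrizableSpaceMetric S
  have hW' : (Subtype.val ⁻¹' W : Set S) ∈ 𝓝 1 := continuous_subtype_val.continuousAt hW
  obtain ⟨V, hV, hVc, hVW⟩ := exists_mem_nhds_isClosed_subset hW'
  have hVn : ¬ IsSeqCompact V := fun h =>
    hS (h.isCompact.locallyCompactSpace_of_mem_nhds_of_group hV)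
  rw [IsSeqCompact] at hVn
  push Not at hVn
  obtain ⟨x, hx, hxV⟩ := hVn
  refine ⟨fun i => x i, fun i => ⟨(x i).2, hVW (hx i)⟩, fun c hc φ hφ hlim => ?_⟩
  have hlim' : Tendsto (x ∘ φ) atTop (𝓝 (⟨c, hc⟩ : S)) := tendsto_subtype_rng.2 hlim
  exact hxV _ (hVc.mem_of_tendsto hlim' (Eventually.of_forall fun i => hx _)) φ hφ hlim'

theorem not_isAscoliSpace_of_not_step (hmono : Monotone H)
    (hmet : ∀ n, TopologicalSpace.MetrizableSpace (H n)) (hcl : ∀ n, IsClosed (H n : Set G))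
    (hcpt : ∀ C : Set G, IsCompact C → ∃ n, C ⊆ H n)
    (hstep : ∀ m, ∃ n ≥ m, (H n : Set G) ∉ 𝓝[H (n + 1)] 1)
    {m : ℕ} (hm : ¬ LocallyCompactSpace (H m)) : ¬ IsAscoliSpace G := by
  obtain ⟨P, hP, hPW⟩ := exists_shrinking_nhds hmet
  choose x hx hxlim using fun k =>
    exists_seq_of_not_locallyCompactSpace (H m) hm ((hP k).1.mem_nhds (hP k).2)
  choose j hj hjstep using fun k => hstep (max k m)
  choose y hy hylim using fun k => exists_seq_of_not_mem_nhdsWithin (hjstep k)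
  have hxj : ∀ k i, x k i ∈ H (j k) := fun k i =>
    hmono ((le_max_right _ _).trans (hj k)) (hx k i).1
  -- Removing `H (j k)` leaves only rows `k < n` for a compact set in `H n`; the shrinking factor `P
  -- i` takes care of each single row.
  refine not_isAscoliSpace_of_compact_finite (fun p : ℕ × ℕ => x p.1 p.2 * y p.1 p.2)
    (fun p => (x p.1 p.2 * y p.1 p.2) • P p.2 ∩ (H (j p.1) : Set G)ᶜ) (fun p => ?_) (fun p => ?_)
    (fun C hC => ?_) 1 (fun O hO => ?_)
  · exact ((hP _).1.smul _).inter (hcl _).isOpen_compl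
  · refine ⟨⟨1, (hP _).2, by simp⟩, fun h => ?_⟩
    exact (hy _ _).2 (((H (j p.1)).mul_mem_cancel_left (hxj _ _)).1 h)
  · obtain ⟨n, hn⟩ := hcpt C hC
    have hk : ∀ k, {i | (C ∩ ((x k i * y k i) • P i ∩ (H (j k) : Set G)ᶜ)).Nonempty}.Finite := by
      intro k
      by_contra hinf
      obtain ⟨φ, hφ, hφC⟩ :=
        extraction_of_frequently_atTop (Nat.frequently_atTop_iff_infinite.2 hinf)
      choose c hcC hcU using hφC
      choose p hp hpc using fun l => (hcU l).1
      simp only [smul_eq_mul] at hpc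
      let N := max n (j k + 1)
      have hcN : ∀ l, c l ∈ H N := fun l => hmono (le_max_left _ _) (hn (hcC l))
      have hC' : IsCompact (Subtype.val ⁻¹' C : Set (H N)) :=
        (IsInducing.subtypeVal.isCompact_preimage_iff (by
          simpa using hn.trans (hmono (le_max_left _ _)))).2 hC
      obtain ⟨d, -, ψ, hψ, hlim⟩ := hC'.tendsto_subseq (x := fun l => ⟨c l, hcN l⟩) hcC
      have hclim : Tendsto (fun l => c (ψ l)) atTop (𝓝 (d : G)) :=
        (continuous_subtype_val.tendsto d).comp hlim
      have haN : ∀ l, x k l * y k l ∈ H N := fun l => hmono (le_max_right _ _)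
        (mul_mem (hmono (Nat.le_succ _) (hxj k l)) (hy k l).1)
      -- Both `c l` and `x k l * y k l` lie in `H N`, hence so does `p l`, and on this one group the
      -- sets `P i` shrink to 1. Thus the row `x k` would have a convergent subsequence.
      have hplim : Tendsto (fun l => p (ψ l)) atTop (𝓝 1) := by
        intro W hW
        have h := (hφ.comp hψ).tendsto_atTop.eventually (hPW N W hW)
        change ∀ᶠ l in atTop, p (ψ l) ∈ W
        filter_upwards [h] with l hl
        refine hl ⟨hp _, ?_⟩
        have := hcN (ψ l)
        rw [← hpc] at this
        exact ((H N).mul_mem_cancel_left (haN _)).1 this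
      have hylim' : Tendsto (fun l => y k (φ (ψ l))) atTop (𝓝 1) :=
        (hylim k).comp (hφ.comp hψ).tendsto_atTop
      have hxd : Tendsto (x k ∘ (φ ∘ ψ)) atTop (𝓝 (d : G)) := by
        have h := (hclim.mul hplim.inv).mul hylim'.inv
        simp only [inv_one, mul_one] at h
        refine h.congr fun l => ?_
        simp [← hpc]
      have hd : (d : G) ∈ H m :=
        (hcl m).mem_of_tendsto hxd (Eventually.of_forall fun l => (hx k _).1)
      exact hxlim k d hd _ (hφ.comp hψ) hxd
    refine ((Finset.range n).finite_toSet.biUnion fun k _ => (hk k).image (Prod.mk k)).subset ?_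
    rintro ⟨k, i⟩ hki
    refine mem_biUnion (x := k) ?_ ⟨i, hki, rfl⟩
    obtain ⟨c, hc, -, hcj⟩ := hki
    by_contra h
    exact hcj (hmono (((by simpa using h : n ≤ k).trans (le_max_left _ _)).trans (hj k)) (hn hc))
  · obtain ⟨V, hV, hV1, hVO⟩ := exists_open_nhds_one_mul_subset hO
    -- A single row suffices: all of `x k` lies in `P k ∩ H m ⊆ V`, and `y k i` is eventually in
    -- `V`.
    obtain ⟨k, hk⟩ := (hPW m V (hV.mem_nhds hV1)).exists
    have hinf := Nat.frequently_atTop_iff_infinite.1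
      ((hylim k).eventually (hV.mem_nhds hV1)).frequently
    refine (hinf.image (f := Prod.mk k) (Prod.mk_right_injective k).injOn).mono ?_
    rintro _ ⟨i, hi, rfl⟩
    exact hVO (mul_mem_mul (hk ⟨(hx k i).2, (hx k i).1⟩) hi)

end IncreasingSubgroups

theorem notMem_closure_of_isClosed_preimage {X : Type*} [TopologicalSpace X] {S B : Set X}
    (hB : IsClosed (Subtype.val ⁻¹' B : Set S)) (hBS : B ⊆ S) {g : X} (hg : g ∈ S) (hgB : g ∉ B) :
    g ∉ closure B := by
  intro h
  have : (⟨g, hg⟩ : S) ∈ closure (Subtype.val ⁻¹' B : Set S) := by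
    rw [closure_subtype, Subtype.image_preimage_coe, inter_eq_right.2 hBS]
    exact h
  rw [hB.closure_eq] at this
  exact hgB this

theorem IsTopologicalGroup.t35Space {X : Type*} [Group X] [TopologicalSpace X]
    [IsTopologicalGroup X] [T2Space X] : T35Space X := by
  let := IsTopologicalGroup.rightUniformSpace X
  exact { }

theorem isOpen_preimage_subgroup_iff {X : Type*} [Group X] [TopologicalSpace X]
    [IsTopologicalGroup X] {A S : Subgroup X} :
    IsOpen (Subtype.val ⁻¹' (A : Set X) : Set S) ↔ (A : Set X) ∈ 𝓝[S] 1 := by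
  rw [nhdsWithin_eq_map_subtype_coe S.one_mem]
  exact ⟨fun h => h.mem_nhds (one_mem A), fun h => (A.subgroupOf S).isOpen_of_mem_nhds (g := 1) h⟩

/-! ### Transfer to the inductive limit of the tower. -/

namespace GroupTower

variable {G : Type u} [Group G]

theorem isTopologicalGroup_grTopology (T : GroupTower G) :
    @IsTopologicalGroup G T.grTopology _ :=
  T.isLeast_grTopology.1.1

theorem indTopology_le_grTopology (T : GroupTower G) : T.indTopology ≤ T.grTopology :=
  iSup_le fun n => (T.isLeast_grTopology.1.2 n).coinduced_le

theorem indTopology_eq_grTopology {T : GroupTower G} (h : @IsTopologicalGroup G T.indTopology _) :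
    T.indTopology = T.grTopology :=
  le_antisymm T.indTopology_le_grTopology
    (T.isLeast_grTopology.2 ⟨h, fun n => continuous_iff_coinduced_le.2 (le_iSup
      (fun n => (T.top n).coinduced (Subtype.val : T.H n → G)) n)⟩)

/-- `indTopology` is a group topology as soon as all sets with open traces are open in
`grTopology`. -/
theorem GC.isTopologicalGroup_indTopology {T : GroupTower G} (hGC : T.GC)
    (h : let := T.grTopology
      ∀ O : Set G, (∀ n, IsOpen[instTopologicalSpaceSubtype] (Subtype.val ⁻¹' O : Set (T.H n))) →
        IsOpen O) :
    @IsTopologicalGroup G T.indTopology _ := by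
  have e : T.indTopology = T.grTopology := by
    refine le_antisymm T.indTopology_le_grTopology fun O hO => h O fun n => ?_
    have := isOpen_coinduced.1 (isOpen_iSup_iff.1 hO n)
    rwa [hGC.top_eq_induced n] at this
  rw [e]
  exact T.isTopologicalGroup_grTopology

theorem sequentialSpace_indTopology {T : GroupTower G}
    (hmetr : ∀ n, TopologicalSpace.MetrizableSpace (T.H n)) :
    @SequentialSpace G T.indTopology :=
  SequentialSpace.iSup fun _ => SequentialSpace.coinduced _

theorem GC.hasProductNhds {T : GroupTower G} (hGC : T.GC) :
    let := T.grTopology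
    HasProductNhds T.H := by
  intro _ W hW
  have hU : ∀ n, ∃ V : Set (T.H n), (@IsOpen _ (T.top n) V ∧ 1 ∈ V ∧ V⁻¹ = V) ∧
      V * V ⊆ Subtype.val ⁻¹' W n := by
    intro n
    refine exists_symm_mul_subset ?_
    have h := hW n
    rw [nhdsWithin_eq_map_subtype_coe (T.H n).one_mem] at h
    rw [hGC.top_eq_induced n]
    exact h
  choose U hU hUW using hU
  refine mem_of_superset (hGC.plusSet_mem_nhds hU) (iUnion_mono fun j => ?_)
  have hUW' : ∀ n, Subtype.val '' U n ⊆ W n := by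
    rintro n _ ⟨x, hx, rfl⟩
    exact hUW n ⟨x, hx, 1, (hU n).2.1, mul_one x⟩
  induction j with
  | zero => exact hUW' 0
  | succ j ih =>
    rw [partialProd, zero_add]
    exact mul_subset_mul ih (hUW' _)

theorem range_inclusion_eq (T : GroupTower G) (n : ℕ) :
    range (Subgroup.inclusion (T.le_succ n)) = Subtype.val ⁻¹' (T.H n : Set G) := by
  ext x
  exact ⟨by rintro ⟨y, rfl⟩; exact y.2, fun h => ⟨⟨x, h⟩, rfl⟩⟩

/-- A point outside `H n` lies in `H (p + 1)` but not in `H p` for some `p ≥ n`, and `H p` is closed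
in `H (p + 1)`, which carries the trace of `grTopology`. -/
theorem GC.isClosed_H {T : GroupTower G} (hGC : T.GC) (hcl : T.IsClosedTower) (n : ℕ) :
    @IsClosed G T.grTopology (T.H n) := by
  let := T.grTopology
  rw [← closure_subset_iff_isClosed]
  intro g hg
  by_contra hgn
  classical
  have hx := T.exhaust g
  have hlt : n < Nat.find hx := by
    by_contra! h
    exact hgn (T.monotone_H h (Nat.find_spec hx))
  obtain ⟨p, hp⟩ : ∃ p, Nat.find hx = p + 1 := ⟨Nat.find hx - 1, by omega⟩
  have hc := hcl p
  rw [range_inclusion_eq, hGC.top_eq_induced (p + 1)] at hc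
  exact notMem_closure_of_isClosed_preimage hc (T.le_succ p) (hp ▸ Nat.find_spec hx)
    (Nat.find_min hx (by omega)) (closure_mono (T.monotone_H (by omega)) hg)

theorem GC.t2Space {T : GroupTower G} (hGC : T.GC)
    (hmetr : ∀ n, TopologicalSpace.MetrizableSpace (T.H n)) : @T2Space G T.grTopology := by
  let := T.grTopology
  have := T.isTopologicalGroup_grTopology
  rw [IsTopologicalGroup.t2Space_iff_one_closed, ← closure_subset_iff_isClosed]
  intro g hg
  by_contra hg1
  obtain ⟨n, hn⟩ := T.exhaust g
  have hc : @IsClosed (T.H n) (T.top n) (Subtype.val ⁻¹' {1}) := by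
    have e : (Subtype.val ⁻¹' {1} : Set (T.H n)) = {1} := by ext; simp
    exact e ▸ isClosed_singleton
  rw [hGC.top_eq_induced n] at hc
  exact notMem_closure_of_isClosed_preimage hc (by simp) hn hg1 hg

theorem GC.isOpenStep_iff {T : GroupTower G} (hGC : T.GC) (n : ℕ) :
    let := T.grTopology
    T.IsOpenStep n ↔ (T.H n : Set G) ∈ 𝓝[T.H (n + 1)] 1 := by
  intro _
  have := T.isTopologicalGroup_grTopology
  rw [IsOpenStep, range_inclusion_eq, hGC.top_eq_induced (n + 1)]
  exact isOpen_preimage_subgroup_iff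

end GroupTower

theorem theoremt {G : Type u} [Group G] (T : GroupTower G)
    (hclosed : T.IsClosedTower)
    (hmetr : ∀ n, TopologicalSpace.MetrizableSpace (T.H n))
    (hGC : T.GC) :
    -- the three assertions are equivalent
    [ @IsAscoliSpace G T.grTopology,
      @IsTopologicalGroup G T.indTopology _,
      (∃ m, ∀ n ≥ m, T.IsOpenStep n) ∨ (∀ n, LocallyCompactSpace (T.H n)) ].TFAE ∧
    -- supplement to the first alternative
    ((∃ m, ∀ n ≥ m, T.IsOpenStep n) → @TopologicalSpace.MetrizableSpace G T.grTopology) ∧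
    -- supplement to the second alternative
    ((∀ n, LocallyCompactSpace (T.H n)) →
      @HasOpenMKOmegaSubgroup G _ T.grTopology ∧
      @SequentialSpace G T.grTopology ∧
      ((¬ ∃ m, ∀ n ≥ m, T.IsOpenStep n) → ¬ @FrechetUrysohnSpace G T.grTopology)) := by
  have hT2 := hGC.t2Space hmetr
  have hgrp := T.isTopologicalGroup_grTopology
  have hcl := hGC.isClosed_H hclosed
  have hcpt : ∀ C : Set G, @IsCompact G T.grTopology C → ∃ n, C ⊆ T.H n :=
    fun C => hGC.exists_subset_of_isCompact hclosed
  have hprod := hGC.hasProductNhds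
  have hstep := hGC.isOpenStep_iff
  have hmono := T.monotone_H
  -- Each `H n` has its own topology and the trace of `grTopology`. They are equal only by
  -- `GC.top_eq_induced`, so metrizability and local compactness are transported along it.
  have hmetr' : ∀ n, @TopologicalSpace.MetrizableSpace (T.H n)
      (T.grTopology.induced Subtype.val) := fun n => hGC.top_eq_induced n ▸ hmetr n
  have hlc : ∀ n, @LocallyCompactSpace (T.H n) (T.top n) ↔
      @LocallyCompactSpace (T.H n) (T.grTopology.induced Subtype.val) := fun n => by
    rw [hGC.top_eq_induced n]
  have hseq : @IsTopologicalGroup G T.indTopology _ → @SequentialSpace G T.grTopology :=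
    fun h => GroupTower.indTopology_eq_grTopology h ▸ GroupTower.sequentialSpace_indTopology hmetr
  have h31 : (∃ m, ∀ n ≥ m, T.IsOpenStep n) →
      ∃ m, IsOpen[T.grTopology] (T.H m : Set G) := by
    rintro ⟨m, hm⟩
    let := T.grTopology
    exact ⟨m, isOpen_of_forall_step hmono hprod fun n hn => (hstep n).1 (hm n hn)⟩
  have h32 : (∃ m, ∀ n ≥ m, T.IsOpenStep n) ∨ (∀ n, LocallyCompactSpace (T.H n)) →
      @IsTopologicalGroup G T.indTopology _ := by
    intro h
    refine hGC.isTopologicalGroup_indTopology ?_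
    intro _ O hO
    rcases h with h | h
    · obtain ⟨m, hm⟩ := h31 h
      exact isOpen_of_isOpen_preimage_of_isOpen_subgroup hmono T.exhaust hm hO
    · exact isOpen_of_isOpen_preimage_of_locallyCompact hmono T.exhaust hprod
        (fun n => (hlc n).1 (h n)) hO
  have hnot : (¬ ∃ m, ∀ n ≥ m, T.IsOpenStep n) →
      let := T.grTopology
      ∀ m, ∃ n ≥ m, (T.H n : Set G) ∉ 𝓝[T.H (n + 1)] 1 := by
    intro h _ m
    push Not at h
    obtain ⟨n, hn, hn'⟩ := h m
    exact ⟨n, hn, fun h' => hn' ((hstep n).2 h')⟩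
  refine ⟨?_, fun h => ?_, fun h => ⟨?_, hseq (h32 (Or.inr h)), fun h' => ?_⟩⟩
  · tfae_have 3 → 2 := h32
    tfae_have 2 → 1 := by
      intro h
      let := T.grTopology
      have := hseq h
      have : T35Space G := IsTopologicalGroup.t35Space
      exact isAscoliSpace_of_sequentialSpace
    tfae_have 1 → 3 := by
      intro h
      by_contra! hcon
      obtain ⟨hcon, m, hm⟩ := hcon
      let := T.grTopology
      refine not_isAscoliSpace_of_not_step hmono hmetr' hcl hcpt (hnot (by push Not; exact hcon))
        (m := m) ?_ h
      exact fun h' => hm ((hlc m).2 h')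
    tfae_finish
  · obtain ⟨m, hm⟩ := h31 h
    let := T.grTopology
    have := hmetr' m
    exact @metrizableSpace_of_isOpen_subgroup G _ _ _ _ (T.H m) hm this
  · let := T.grTopology
    exact hasOpenMKOmegaSubgroup_of_locallyCompact hmono T.exhaust hprod
      (fun n => (hlc n).1 (h n)) hmetr'
  · let := T.grTopology
    exact not_frechetUrysohnSpace_of_not_step hmono hmetr' hcpt (hnot h')
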